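/- Theorem 1.2. For $n\ge 0$ and $\phi\in\mathrm{Aut}(\mathbb Z^n)$ let $\mathbb Z^n\rtimes_\phi\mathbb Z$ be the mapping torus, i.e. the semidirect product in which the generator of $\mathbb Z$ acts on $\mathbb Z^n$ by $\phi$, and let the rank of a finitely generated group be the minimum cardinality of a generating set. (1) There is an algorithm (one algorithm for all $n$) which, given the matrix $A\in GL_n(\mathbb Z)$ of an automorphism $\phi$ of $\mathbb Z^n$ with respect to some basis of $\mathbb Z^n$, decides whether the rank of $\mathbb Z^n\rtimes_\phi\mathbb Z$ is equal to $n+1$. (2) Suppose $n\ge 3$, let $\phi\in\mathrm{Aut}(\mathbb Z^n)$ and let $A=(a_{ij})$ be the matrix of $\phi$ with respect to any basis of $\mathbb Z^n$. Then $\mathbb Z^n\rtimes_\phi\mathbb Z$ has rank $n+1$ if and only if $\gcd(A-a_{11}I)\neq 1$, where $\gcd(M)$ denotes the greatest common divisor of the absolute values of all entries of $M$, with $\gcd(0)=0$. -/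

import Mathlib

/-- The mapping torus `F ⋊_φ ℤ` of an automorphism `φ` of a group `F`: the generator of `ℤ` acts
on `F` by `φ`, so `k : ℤ` acts by `φ ^ k`. -/
abbrev MappingTorus {F : Type*} [Group F] (φ : MulAut F) : Type _ :=
  F ⋊[zpowersHom (MulAut F) φ] Multiplicative ℤ

/-- The mapping torus of a finitely generated group is finitely generated; `Group.rank`, the
minimum cardinality of a generating set, is defined for finitely generated groups. -/
instance MappingTorus.fg {F : Type*} [Group F] [Group.FG F] (φ : MulAut F) :
    Group.FG (MappingTorus φ) := by
  have h1 : (SemidirectProduct.inl : F →* MappingTorus φ).range.FG :=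
    (Group.fg_iff_subgroup_fg _).mp inferInstance
  have h2 : (SemidirectProduct.inr : Multiplicative ℤ →* MappingTorus φ).range.FG :=
    (Group.fg_iff_subgroup_fg _).mp inferInstance
  obtain ⟨S, hS⟩ := h1
  obtain ⟨T, hT⟩ := h2
  classical
  refine ⟨⟨S ∪ T, ?_⟩⟩
  rw [Finset.coe_union, Subgroup.closure_union, hS, hT, eq_top_iff]
  intro g _
  rw [← SemidirectProduct.inl_left_mul_inr_right g]
  exact Subgroup.mul_mem_sup ⟨_, rfl⟩ ⟨_, rfl⟩

/-- The group `ℤⁿ ⋊_φ ℤ` for `φ ∈ Aut(ℤⁿ)`, with `ℤⁿ` written multiplicatively. -/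
abbrev ZnMappingTorus {n : ℕ} (φ : AddAut (Fin n → ℤ)) : Type :=
  MappingTorus (F := Multiplicative (Fin n → ℤ)) (AddEquiv.toMultiplicative φ)

/-- The integer matrix of `φ ∈ Aut(ℤⁿ)` in the basis `b` of `ℤⁿ`: its `j`-th column consists of
the coordinates of `φ (b j)`. -/
noncomputable def autMatrix {n : ℕ} (b : Module.Basis (Fin n) ℤ (Fin n → ℤ))
    (φ : AddAut (Fin n → ℤ)) : Matrix (Fin n) (Fin n) ℤ :=
  LinearMap.toMatrix b b (φ.toIntLinearEquiv : (Fin n → ℤ) →ₗ[ℤ] (Fin n → ℤ))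

/-- A square integer matrix written down as the list of its rows, as input for an algorithm. -/
def matrixRows {n : ℕ} (A : Matrix (Fin n) (Fin n) ℤ) : List (List ℤ) :=
  List.ofFn fun i => List.ofFn fun j => A i j

/-- The greatest common divisor of the absolute values of all entries of an integer matrix. It is
`0` for the zero matrix. -/
def entriesGcd {n : ℕ} (A : Matrix (Fin n) (Fin n) ℤ) : ℕ :=
  (Finset.univ : Finset (Fin n × Fin n)).gcd fun p => (A p.1 p.2).natAbs

/-! The rank is at most `n + 1`. Equality is forced when `φ` is a scalar modulo some prime `p`: the
mapping torus then has a crossed homomorphism to `𝔽_p ^ (n + 1)` whose action is by scalars and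
whose values span, so `n` elements cannot generate (`ZnMappingTorus.lt_rank_of_scalar_mod`). Being
scalar modulo a prime means exactly that `gcd(A - a₁₁ I) ≠ 1`, the value `0` included.

Conversely, suppose a vector `v` and a functional `w` satisfy `w v = 0` and `w (φ v) = 1`. A basis
of `ker w` together with the stable letter then generates, so the rank is at most `n`
(`ZnMappingTorus.rank_le_of_apply_eq_one`). For `n ≥ 3` such a pair exists unless `φ` is scalar
modulo a prime (`LinearMap.exists_apply_eq_one`): let `g` be the least positive value of `w (φ v)`
over pairs with `w v = 0`; if a prime `p` divides `g`, testing minimality on nearby pairs shows that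
`φ` is scalar modulo `p`.

This settles `n ≥ 3`, and `n ≤ 1` always gives rank `n + 1`. For `n = 2` the rank is at most `2` iff
some `u` and `φ u` generate `ℤ²`, that is, iff the binary quadratic form `det (u, φ u)` represents
`±1`. Since `φ` preserves this form up to sign, a representation can be moved into an explicit box
(`exists_cyclicForm_le`), so a bounded search decides. -/

/-! ### Divisibility forced by minimality in `ℤ` -/

/-- If `g > 0` is at most the absolute value of every nonzero integer combination of `g` and `m`,
then `g` divides `m`. -/
theorem Int.dvd_of_forall_le_abs_comb {g m : ℤ} (hg : 0 < g)
    (h : ∀ x y : ℤ, x * g + y * m ≠ 0 → g ≤ |x * g + y * m|) : g ∣ m := by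
  by_contra hd
  have hne : (-(m / g)) * g + 1 * m = m % g := by
    have := Int.emod_add_mul_ediv m g
    linarith
  have h0 : m % g ≠ 0 := fun h0 => hd (Int.dvd_of_emod_eq_zero h0)
  have := h (-(m / g)) 1 (by rwa [hne])
  rw [hne, abs_of_nonneg (Int.emod_nonneg _ hg.ne')] at this
  exact absurd (Int.emod_lt_of_pos m hg) (not_lt.2 this)

/-- By Bézout the gcd of `p * g` and `m` is itself a combination, hence at least `g`. If `p ∤ m` it
is prime to `p`, so it divides `g` and equals `g`; but `p ∣ g`. -/
theorem Int.dvd_of_forall_le_abs_comb_mul {g m p : ℤ} (hp : Prime p) (hg : 0 < g) (hpg : p ∣ g)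
    (h : ∀ x y : ℤ, x * (p * g) + y * m ≠ 0 → g ≤ |x * (p * g) + y * m|) : p ∣ m := by
  by_contra hd
  have hb := Int.gcd_eq_gcd_ab (p * g) m
  have hne : (Int.gcd (p * g) m : ℤ) ≠ 0 := by
    rw [Ne, Int.natCast_eq_zero, Int.gcd_eq_zero_iff]
    rintro ⟨-, rfl⟩
    exact hd (dvd_zero p)
  have hle := h (Int.gcdA (p * g) m) (Int.gcdB (p * g) m) (by
    rw [mul_comm _ (p * g), mul_comm _ m, ← hb]; exact hne)
  rw [mul_comm _ (p * g), mul_comm _ m, ← hb, Nat.abs_cast] at hle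
  have h1 : IsCoprime (Int.gcd (p * g) m : ℤ) p := by
    refine ((hp.irreducible.coprime_iff_not_dvd).2 fun h2 => hd (h2.trans (Int.gcd_dvd_right ..))).symm
  have h2 : (Int.gcd (p * g) m : ℤ) ∣ g := h1.dvd_of_dvd_mul_left (Int.gcd_dvd_left ..)
  have h3 : (Int.gcd (p * g) m : ℤ) = g := le_antisymm (Int.le_of_dvd hg h2) hle
  exact hd ((hpg.trans h3.symm.dvd).trans (Int.gcd_dvd_right ..))

/-! ### Least positive value of `w (f v)` over pairs with `w v = 0` -/

section
variable {M : Type*} [AddCommGroup M] [Module.Free ℤ M] [Module.Finite ℤ M]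

theorem LinearMap.exists_eq_smul_of_forall_dvd {g : ℤ} (h : M →ₗ[ℤ] ℤ) (hd : ∀ x, g ∣ h x) :
    ∃ d : M →ₗ[ℤ] ℤ, h = g • d := by
  choose d hd using hd
  let b := Module.Free.chooseBasis ℤ M
  refine ⟨b.constr ℤ fun i => d (b i), b.ext fun i => ?_⟩
  simp [hd]

theorem Module.Free.exists_eq_smul_of_forall_dvd {g : ℤ} (x : M)
    (hd : ∀ w : M →ₗ[ℤ] ℤ, g ∣ w x) : ∃ c : M, x = g • c := by
  let b := Module.Free.chooseBasis ℤ M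
  choose d hd using fun i => hd (b.coord i)
  refine ⟨∑ i, d i • b i, ?_⟩
  conv_lhs => rw [← b.sum_repr x]
  rw [Finset.smul_sum]
  refine Finset.sum_congr rfl fun i _ => ?_
  rw [smul_smul, ← hd i, Module.Basis.coord_apply]

variable {f : M →ₗ[ℤ] M} {g : ℤ}

/-- Minimality is used on both sides: with `v` fixed it controls `f v` modulo `g`, and with `w`
fixed it controls `w ∘ f` modulo `g`. The vectors `v, c` and the functionals `d, w` come out as dual
systems, so they split off a rank two summand. -/
theorem LinearMap.exists_normal_form (hg : 0 < g)
    (hmin : ∀ (v : M) (w : M →ₗ[ℤ] ℤ), w v = 0 → w (f v) ≠ 0 → g ≤ |w (f v)|)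
    {v : M} {w : M →ₗ[ℤ] ℤ} (hwv : w v = 0) (hval : w (f v) = g) :
    ∃ (a b : ℤ) (c : M) (d : M →ₗ[ℤ] ℤ), w c = 1 ∧ d v = 1 ∧ d c = 0 ∧ f v = a • v + g • c ∧
      ∀ x, w (f x) = b * w x + g * d x := by
  obtain ⟨k, hk⟩ := (IsPrincipalIdealRing.principal (LinearMap.range w)).principal
  obtain ⟨c₀, hc₀⟩ : k ∈ LinearMap.range w := by rw [hk]; exact Submodule.mem_span_singleton_self k
  have hkd : ∀ x, k ∣ w x := fun x => by
    have : w x ∈ LinearMap.range w := ⟨x, rfl⟩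
    rw [hk] at this
    exact Ideal.mem_span_singleton.1 this
  obtain ⟨w₀, hw₀⟩ := w.exists_eq_smul_of_forall_dvd hkd
  have hk0 : k ≠ 0 := by
    rintro rfl
    simp [hw₀] at hval
    exact hg.ne hval
  -- Dividing `w` by its content `k` would give a smaller nonzero value.
  have hku : IsUnit k := by
    have h1 : k * w₀ (f v) = g := by rw [← hval, hw₀]; simp
    have h2 : w₀ v = 0 := by
      have : k * w₀ v = 0 := by rw [← hwv, hw₀]; simp
      exact (mul_eq_zero.1 this).resolve_left hk0
    have h3 : w₀ (f v) ≠ 0 := fun h => by rw [h, mul_zero] at h1; exact hg.ne h1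
    have h4 := hmin v w₀ h2 h3
    have h5 : |k| * |w₀ (f v)| = g := by rw [← abs_mul, h1, abs_of_pos hg]
    rw [Int.isUnit_iff_abs_eq]
    have h6 : 0 < |w₀ (f v)| := abs_pos.2 h3
    have h7 : 0 < |k| := abs_pos.2 hk0
    nlinarith
  obtain ⟨c₁, hc₁⟩ : ∃ c₁, w c₁ = 1 := ⟨k • c₀, by
    rw [map_smul, hc₀, smul_eq_mul, Int.isUnit_mul_self hku]⟩
  have hR : ∀ x, w x = 0 → g ∣ w (f x) := fun x hx => by
    refine Int.dvd_of_forall_le_abs_comb hg fun s t hne => ?_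
    have := hmin (s • v + t • x) w (by simp [hwv, hx])
    simp only [map_add, map_smul, hval, smul_eq_mul] at this
    exact this hne
  obtain ⟨d, hd⟩ := (w ∘ₗ f - w (f c₁) • w).exists_eq_smul_of_forall_dvd (g := g) fun x => by
    have := hR (x - w x • c₁) (by simp [hc₁])
    simpa [mul_comm] using this
  have hd' : ∀ x, w (f x) = w (f c₁) * w x + g * d x := fun x => by
    have := LinearMap.congr_fun hd x
    simp only [LinearMap.sub_apply, LinearMap.comp_apply, LinearMap.smul_apply, smul_eq_mul] at this
    linarith
  have hdv : d v = 1 := by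
    have := hd' v
    rw [hwv, hval] at this
    exact mul_left_cancel₀ hg.ne' (by linarith)
  -- As `d v = 1`, the functional `u - u v • d` kills `v`, so it may be combined with `w`.
  obtain ⟨c, hc⟩ := Module.Free.exists_eq_smul_of_forall_dvd (g := g) (f v - d (f v) • v) fun u => by
    refine Int.dvd_of_forall_le_abs_comb hg fun s t hne => ?_
    have := hmin v (s • w + t • (u - u v • d)) (by simp [hwv, hdv])
    simp only [LinearMap.add_apply, LinearMap.smul_apply, LinearMap.sub_apply, hval,
      smul_eq_mul] at this
    have e : u (f v - d (f v) • v) = u (f v) - u v * d (f v) := by simp [mul_comm]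
    rw [e] at hne ⊢
    exact this hne
  have hfv : f v = d (f v) • v + g • c := by rw [← hc]; abel
  have hwc : w c = 1 := by
    have : w (f v) = g * w c := by rw [hfv]; simp [hwv]
    exact mul_left_cancel₀ hg.ne' (by linarith)
  refine ⟨d (f v), w (f c₁) + g * d c, c, d - d c • w, hwc, by simp [hdv, hwv], by simp [hwc], hfv,
    fun x => ?_⟩
  rw [hd' x]
  simp
  ring

/-- Complete `v, c` to a basis by a basis `β` of `ker w ⊓ ker d`. Each matrix entry of `f` is
reached by perturbing the pair `(v, w)` to one that still has value `g` or `p * g`, then varying the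
functional (`left`, `left'`) or the vector (`right`, `right'`). The rank hypothesis makes `β`
nonempty, which the entries `w (f c)` and `d (f c)` need. -/
theorem LinearMap.dvd_apply_of_normal_form (hM : 3 ≤ Module.finrank ℤ M) {p : ℤ} (hp : Prime p)
    (hg : 0 < g) (hpg : p ∣ g)
    (hmin : ∀ (v : M) (w : M →ₗ[ℤ] ℤ), w v = 0 → w (f v) ≠ 0 → g ≤ |w (f v)|)
    {v c : M} {w d : M →ₗ[ℤ] ℤ} {b : ℤ} (hwv : w v = 0) (hwc : w c = 1) (hdv : d v = 1)
    (hdc : d c = 0) (hfv : f v = g • c) (hwf : ∀ x, w (f x) = b * w x + g * d x)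
    (l : M →ₗ[ℤ] ℤ) (x : M) : p ∣ l (f x) := by
  have left : ∀ (v' : M) (w₁ w₂ : M →ₗ[ℤ] ℤ), w₁ v' = 0 → w₂ v' = 0 → w₁ (f v') = g →
      g ∣ w₂ (f v') := fun v' w₁ w₂ h₁ h₂ h => by
    refine Int.dvd_of_forall_le_abs_comb hg fun s t hne => ?_
    have := hmin v' (s • w₁ + t • w₂) (by simp [h₁, h₂])
    simp only [LinearMap.add_apply, LinearMap.smul_apply, h, smul_eq_mul] at this
    exact this hne
  have left' : ∀ (v' : M) (w₁ w₂ : M →ₗ[ℤ] ℤ), w₁ v' = 0 → w₂ v' = 0 → w₁ (f v') = p * g →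
      p ∣ w₂ (f v') := fun v' w₁ w₂ h₁ h₂ h => by
    refine Int.dvd_of_forall_le_abs_comb_mul hp hg hpg fun s t hne => ?_
    have := hmin v' (s • w₁ + t • w₂) (by simp [h₁, h₂])
    simp only [LinearMap.add_apply, LinearMap.smul_apply, h, smul_eq_mul] at this
    exact this hne
  have right : ∀ (v₁ v₂ : M) (w' : M →ₗ[ℤ] ℤ), w' v₁ = 0 → w' v₂ = 0 → w' (f v₁) = g →
      g ∣ w' (f v₂) := fun v₁ v₂ w' h₁ h₂ h => by
    refine Int.dvd_of_forall_le_abs_comb hg fun s t hne => ?_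
    have := hmin (s • v₁ + t • v₂) w' (by simp [h₁, h₂])
    simp only [map_add, map_smul, h, smul_eq_mul] at this
    exact this hne
  have right' : ∀ (v₁ v₂ : M) (w' : M →ₗ[ℤ] ℤ), w' v₁ = 0 → w' v₂ = 0 → w' (f v₁) = p * g →
      p ∣ w' (f v₂) := fun v₁ v₂ w' h₁ h₂ h => by
    refine Int.dvd_of_forall_le_abs_comb_mul hp hg hpg fun s t hne => ?_
    have := hmin (s • v₁ + t • v₂) w' (by simp [h₁, h₂])
    simp only [map_add, map_smul, h, smul_eq_mul] at this
    exact this hne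
  let K : Submodule ℤ M := LinearMap.ker w ⊓ LinearMap.ker d
  let β := Module.Free.chooseBasis ℤ K
  let π : M →ₗ[ℤ] K := LinearMap.codRestrict K
    (LinearMap.id - d.smulRight v - w.smulRight c) fun x => by
      simp [K, hwv, hwc, hdv, hdc]
  let κ := fun i => β.coord i ∘ₗ π
  have hπ : ∀ x, (π x : M) = x - d x • v - w x • c := fun x => rfl
  have hwβ : ∀ i, w (β i) = 0 := fun i => (β i).2.1
  have hdβ : ∀ i, d (β i) = 0 := fun i => (β i).2.2
  have hκv : ∀ i, κ i v = 0 := fun i => by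
    have : π v = 0 := Subtype.ext (by simp [hπ, hwv, hdv])
    simp [κ, this]
  have hκc : ∀ i, κ i c = 0 := fun i => by
    have : π c = 0 := Subtype.ext (by simp [hπ, hwc, hdc])
    simp [κ, this]
  have hπβ : ∀ i, π (β i) = β i := fun i => Subtype.ext (by simp [hπ, hwβ, hdβ])
  have hκβ : ∀ i, κ i (β i) = 1 := fun i => by simp [κ, hπβ]
  have hκβ' : ∀ i j, i ≠ j → κ j (β i) = 0 := fun i j h => by
    simp [κ, hπβ, h]
  have hsum : ∀ x, x = d x • v + w x • c + ∑ i, κ i x • (β i : M) := fun x => by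
    have h1 : (π x : M) = ∑ i, κ i x • (β i : M) := by
      conv_lhs => rw [← β.sum_repr (π x)]
      rw [Submodule.coe_sum]
      rfl
    rw [← h1, hπ]
    abel
  have hspan : ∀ ψ : M →ₗ[ℤ] ℤ, p ∣ ψ v → p ∣ ψ c → (∀ i, p ∣ ψ (β i)) → ∀ x, p ∣ ψ x := by
    intro ψ h1 h2 h3 x
    rw [hsum x]
    simp only [map_add, map_smul, map_sum, smul_eq_mul]
    exact dvd_add (dvd_add (h1.mul_left _) (h2.mul_left _))
      (Finset.dvd_sum fun i _ => (h3 i).mul_left _)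
  obtain ⟨i₀⟩ : Nonempty (Module.Free.ChooseBasisIndex ℤ K) := by
    by_contra hemp
    rw [not_nonempty_iff] at hemp
    have htop : Submodule.span ℤ (Set.range ![v, c]) = ⊤ := by
      rw [eq_top_iff]
      intro x _
      rw [hsum x]
      simp only [Finset.univ_eq_empty, Finset.sum_empty, add_zero]
      exact Submodule.add_mem _ (Submodule.smul_mem _ _ (Submodule.subset_span ⟨0, rfl⟩))
        (Submodule.smul_mem _ _ (Submodule.subset_span ⟨1, rfl⟩))
    have := finrank_le_of_span_eq_top htop
    simp at this
    omega
  have hval : w (f v) = g := by simp [hwf, hwv, hdv]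
  have e1 : ∀ i, p ∣ d (f (β i)) := fun i => by
    have := left' (p • v + β i) w (d - p • κ i) (by simp [hwv, hwβ]) (by simp [hdv, hdβ, hκv, hκβ])
      (by simp [hwf, hwv, hwβ, hdv, hdβ])
    simp only [map_add, map_smul, LinearMap.sub_apply, LinearMap.smul_apply, hfv, hdc, hκc,
      smul_eq_mul, mul_zero, sub_self, zero_add] at this
    exact (dvd_sub_left (dvd_mul_right _ _)).1 this
  have hval2 : ∀ i, w (f (v + β i)) = g := fun i => by simp [hwf, hwv, hdv, hwβ, hdβ]
  have e2 : ∀ i j, p ∣ κ j (f (β i)) := fun i j => by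
    by_cases hij : i = j
    · subst hij
      have := hpg.trans (left (v + β i) w (d - κ i) (by simp [hwv, hwβ])
        (by simp [hdv, hdβ, hκv, hκβ]) (hval2 i))
      simp only [map_add, map_smul, LinearMap.sub_apply, hfv, hdc, hκc, smul_eq_mul, mul_zero,
        sub_self, zero_add] at this
      exact (dvd_sub_right (e1 i)).1 this
    · have := hpg.trans (left (v + β i) w (κ j) (by simp [hwv, hwβ])
        (by simp [hκv, hκβ' i j hij]) (hval2 i))
      simpa [hfv, hκc] using this
  have hwfc : w (f c) = b := by simp [hwf, hwc, hdc]
  have hwfβ : ∀ i, w (f (β i)) = 0 := fun i => by simp [hwf, hwβ, hdβ]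
  have hκfv : ∀ i, κ i (f v) = 0 := fun i => by simp [hfv, hκc]
  have e4 : ∀ i, p ∣ κ i (f c) := fun i => by
    have := right' v (c - p • (β i : M)) (p • w + κ i) (by simp [hwv, hκv])
      (by simp [hwc, hwβ, hκc, hκβ]) (by simp [hval, hκfv])
    simp only [map_sub, map_smul, LinearMap.add_apply, LinearMap.smul_apply, hwfc, hwfβ,
      smul_eq_mul, mul_zero] at this
    have h3 : p * b + κ i (f c) - p * (0 + κ i (f (β i))) =
        p * (b - κ i (f (β i))) + κ i (f c) := by ring
    rw [h3] at this
    exact (dvd_add_right (dvd_mul_right _ _)).1 this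
  have e3 : p ∣ b := by
    have := hpg.trans (right v (c - β i₀) (w + κ i₀) (by simp [hwv, hκv])
      (by simp [hwc, hwβ, hκc, hκβ]) (by simp [hval, hκfv]))
    simp only [map_sub, LinearMap.add_apply, hwfc, hwfβ, zero_add] at this
    exact (dvd_add_left (e4 i₀)).1 ((dvd_sub_left (e2 i₀ i₀)).1 this)
  have e5 : p ∣ d (f c) := by
    obtain ⟨s, hs⟩ := right v (β i₀ + c) (w - κ i₀) (by simp [hwv, hκv])
      (by simp [hwc, hwβ, hκc, hκβ]) (by simp [hval, hκfv])
    -- The value at `β i₀ + c` is `g * s`, and `v` contributes `g`; adding `(p - s) • v` tunes it to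
    -- `p * g`.
    have hvw : (w - κ i₀) (f ((p - s) • v + (β i₀ + c))) = p * g := by
      rw [map_add, map_add, hs, map_smul, map_smul, LinearMap.sub_apply, hval, hκfv]
      simp
      ring
    have := left' ((p - s) • v + (β i₀ + c)) (w - κ i₀) (d - (p - s) • κ i₀)
      (by simp [hwv, hκv, hwc, hwβ, hκc, hκβ]) (by simp [hdv, hdc, hdβ, hκv, hκc, hκβ]) hvw
    simp only [map_add, map_smul, LinearMap.sub_apply, LinearMap.smul_apply, hfv, hdc, hκc,
      smul_eq_mul, mul_zero, sub_self, zero_add] at this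
    rw [sub_add_sub_comm, ← mul_add] at this
    have h3 := (dvd_sub_left (((e2 i₀ i₀).add (e4 i₀)).mul_left (p - s))).1 this
    exact (dvd_add_right (e1 i₀)).1 h3
  have h1 : p ∣ d (f x) := hspan (d ∘ₗ f) (by simp [hfv, hdc]) e5 e1 x
  have h2 : p ∣ w (f x) := hspan (w ∘ₗ f) (by simpa [hval] using hpg) (by simpa [hwfc] using e3)
    (by simp [hwfβ]) x
  have h3 : ∀ i, p ∣ κ i (f x) := fun i =>
    hspan (κ i ∘ₗ f) (by simp [hκfv]) (e4 i) (fun j => e2 j i) x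
  rw [hsum (f x)]
  simp only [map_add, map_smul, map_sum, smul_eq_mul]
  exact dvd_add (dvd_add (h1.mul_right _) (h2.mul_right _))
    (Finset.dvd_sum fun i _ => (h3 i).mul_right _)

/-- If the values `w (f v)` with `w v = 0` have no common divisor, one of them is `1`. -/
theorem LinearMap.exists_apply_eq_one (f : M →ₗ[ℤ] M) (hM : 3 ≤ Module.finrank ℤ M)
    (h : ∀ m : ℤ, (∀ (v : M) (w : M →ₗ[ℤ] ℤ), w v = 0 → m ∣ w (f v)) → IsUnit m) :
    ∃ (v : M) (w : M →ₗ[ℤ] ℤ), w v = 0 ∧ w (f v) = 1 := by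
  classical
  have hex : ∃ n : ℕ, 0 < n ∧ ∃ (v : M) (w : M →ₗ[ℤ] ℤ), w v = 0 ∧ w (f v) = n := by
    by_contra hno
    -- If all values vanished, `0` would be a common divisor and hence a unit.
    have := h 0 fun v w hwv => by
      by_contra hne
      rw [zero_dvd_iff] at hne
      rcases lt_or_gt_of_ne hne with hlt | hlt
      · exact hno ⟨(w (f v)).natAbs, by omega, v, -w, by simp [hwv], by rw [LinearMap.neg_apply]; omega⟩
      · exact hno ⟨(w (f v)).natAbs, by omega, v, w, hwv, by omega⟩
    simp at this
  obtain ⟨hg, v, w, hwv, hval⟩ := Nat.find_spec hex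
  set g := Nat.find hex with hgdef
  have hmin : ∀ (v : M) (w : M →ₗ[ℤ] ℤ), w v = 0 → w (f v) ≠ 0 → (g : ℤ) ≤ |w (f v)| := by
    intro v w hwv hne
    have : g ≤ (w (f v)).natAbs := by
      refine Nat.find_min' hex ⟨by omega, ?_⟩
      rcases lt_or_gt_of_ne hne with hlt | hlt
      · exact ⟨v, -w, by simp [hwv], by rw [LinearMap.neg_apply]; omega⟩
      · exact ⟨v, w, hwv, by omega⟩
    rw [Int.abs_eq_natAbs]
    omega
  by_cases hg1 : g = 1
  · exact ⟨v, w, hwv, by rw [hval, hg1]; rfl⟩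
  exfalso
  obtain ⟨q, hq, hqg⟩ := Nat.exists_prime_and_dvd hg1
  have hp : Prime (q : ℤ) := Nat.prime_iff_prime_int.1 hq
  refine hp.not_isUnit (h q fun v' w' hwv' => ?_)
  have hg' : (0 : ℤ) < g := by exact_mod_cast hg
  obtain ⟨a, b, c, d, hwc, hdv, hdc, hfv, hwf⟩ := LinearMap.exists_normal_form hg' hmin hwv hval
  -- Subtracting a scalar does not change `w (f v)` when `w v = 0`, so the coefficient `a` may be
  -- taken to be `0`.
  have hshift : ∀ (v : M) (w : M →ₗ[ℤ] ℤ), w v = 0 →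
      w ((f - a • LinearMap.id : M →ₗ[ℤ] M) v) = w (f v) :=
    fun v w hwv => by simp [hwv]
  rw [← hshift v' w' hwv']
  refine LinearMap.dvd_apply_of_normal_form (f := f - a • LinearMap.id) (b := b - a) hM hp hg'
    (Int.natCast_dvd_natCast.2 hqg) (fun v w hwv hne => ?_) hwv hwc hdv hdc (by simp [hfv])
    (fun x => ?_) w' v'
  · rw [hshift v w hwv] at hne ⊢
    exact hmin v w hwv hne
  · simp [hwf]
    ring

end

/-! ### Upper and lower bounds for the rank of the mapping torus -/

section
variable {n : ℕ} (φ : AddAut (Fin n → ℤ))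

/-- The stable letter of the mapping torus. -/
def ZnMappingTorus.stable : ZnMappingTorus φ := SemidirectProduct.inr (Multiplicative.ofAdd 1)

/-- The fibre of the mapping torus. -/
def ZnMappingTorus.fibre : Multiplicative (Fin n → ℤ) →* ZnMappingTorus φ := SemidirectProduct.inl

theorem ZnMappingTorus.stable_mul_fibre_mul_inv (x : Fin n → ℤ) :
    stable φ * fibre φ (Multiplicative.ofAdd x) * (stable φ)⁻¹ =
      fibre φ (Multiplicative.ofAdd (φ x)) := by
  have := (SemidirectProduct.inl_aut (φ := zpowersHom (MulAut (Multiplicative (Fin n → ℤ)))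
    (AddEquiv.toMultiplicative φ)) (Multiplicative.ofAdd 1) (Multiplicative.ofAdd x))
  rw [map_inv] at this
  rw [stable, fibre, ← this]
  simp

theorem ZnMappingTorus.eq_fibre_mul_stable_zpow (g : ZnMappingTorus φ) :
    g = fibre φ g.left * stable φ ^ (Multiplicative.toAdd g.right) := by
  rw [stable, ← map_zpow, ← ofAdd_zsmul]
  simp [fibre]

/-- Conjugation by the stable letter is `φ`, so the fibre part of the generated subgroup is
`φ`-invariant. -/
theorem ZnMappingTorus.rank_le_card_add_one (s : Finset (Fin n → ℤ))
    (hs : ∀ L : AddSubgroup (Fin n → ℤ), ↑s ⊆ (L : Set (Fin n → ℤ)) → (∀ x ∈ L, φ x ∈ L) → L = ⊤) :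
    Group.rank (ZnMappingTorus φ) ≤ s.card + 1 := by
  classical
  let S : Finset (ZnMappingTorus φ) :=
    insert (stable φ) (s.image fun x => fibre φ (Multiplicative.ofAdd x))
  let H := Subgroup.closure (S : Set (ZnMappingTorus φ))
  have ht : stable φ ∈ H := Subgroup.subset_closure (by simp [S])
  have hL := hs (Subgroup.toAddSubgroup' (H.comap (fibre φ)))
    (fun x hx => Subgroup.subset_closure (by
      simp only [S, Finset.coe_insert, Finset.coe_image]
      exact Or.inr ⟨x, hx, rfl⟩))
    (fun x hx => by
      have hx' : fibre φ (Multiplicative.ofAdd x) ∈ H := hx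
      have := H.mul_mem (H.mul_mem ht hx') (H.inv_mem ht)
      rw [stable_mul_fibre_mul_inv] at this
      exact this)
  have hH : H = ⊤ := by
    rw [eq_top_iff]
    intro g _
    rw [eq_fibre_mul_stable_zpow φ g]
    refine H.mul_mem ?_ (H.zpow_mem ht _)
    have : Multiplicative.toAdd g.left ∈ Subgroup.toAddSubgroup' (H.comap (fibre φ)) := by
      rw [hL]; trivial
    exact this
  refine (Group.rank_le hH).trans ((Finset.card_insert_le _ _).trans ?_)
  exact Nat.add_le_add_right Finset.card_image_le 1

theorem AddSubgroup.eq_top_of_forall_basis_mem {ι M : Type*} [AddCommGroup M]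
    (b : Module.Basis ι ℤ M) (L : AddSubgroup M) (h : ∀ i, b i ∈ L) : L = ⊤ := by
  have : (AddSubgroup.toIntSubmodule L) = ⊤ := by
    rw [eq_top_iff, ← b.span_eq, Submodule.span_le]
    rintro _ ⟨i, rfl⟩
    exact h i
  simpa using this

theorem ZnMappingTorus.rank_le : Group.rank (ZnMappingTorus φ) ≤ n + 1 := by
  classical
  refine (rank_le_card_add_one φ (Finset.univ.image (Pi.basisFun ℤ (Fin n))) fun L hL _ =>
    L.eq_top_of_forall_basis_mem (Pi.basisFun ℤ (Fin n)) fun i => hL (by simp)).trans ?_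
  exact Nat.add_le_add_right (Finset.card_image_le.trans (by simp)) 1

/-- The kernel of `w` has rank `n - 1`. Once it lies in a `φ`-invariant subgroup, so does `φ v`,
which generates a complement of it. -/
theorem ZnMappingTorus.rank_le_of_apply_eq_one {v : Fin n → ℤ} {w : (Fin n → ℤ) →ₗ[ℤ] ℤ}
    (hwv : w v = 0) (hw : w (φ v) = 1) : Group.rank (ZnMappingTorus φ) ≤ n := by
  classical
  let β := Module.Free.chooseBasis ℤ (LinearMap.ker w)
  have hcard : Fintype.card (Module.Free.ChooseBasisIndex ℤ (LinearMap.ker w)) + 1 = n := by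
    have h1 := Submodule.finrank_quotient_add_finrank (LinearMap.ker w)
    rw [w.quotKerEquivRange.finrank_eq] at h1
    have h2 : LinearMap.range w = ⊤ := by
      rw [LinearMap.range_eq_top]
      exact fun k => ⟨k • φ v, by rw [map_smul, hw, smul_eq_mul, mul_one]⟩
    rw [h2, finrank_top, Module.finrank_self, Module.finrank_fin_fun,
      Module.finrank_eq_card_chooseBasisIndex] at h1
    omega
  refine (rank_le_card_add_one φ (Finset.univ.image fun i => (β i : Fin n → ℤ))
    fun L hL hφ => ?_).trans ?_
  · have hker : ∀ x, w x = 0 → x ∈ L := fun x hx => by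
      have := congrArg Subtype.val (β.sum_repr ⟨x, hx⟩)
      rw [Submodule.coe_sum] at this
      rw [show x = _ from this.symm]
      refine L.sum_mem fun i _ => ?_
      exact L.zsmul_mem (hL (by simp)) _
    rw [eq_top_iff]
    intro x _
    have h1 : x - w x • φ v ∈ L := hker _ (by rw [map_sub, map_smul, hw]; simp)
    have h2 : w x • φ v ∈ L := L.zsmul_mem (hφ _ (hker v hwv)) _
    simpa using L.add_mem h1 h2
  · exact (Nat.add_le_add_right (Finset.card_image_le.trans (by simp)) 1).trans hcard.le

/-- The geometric sum `1 + a + ⋯ + a ^ (k - 1)`, continued to negative `k`. -/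
theorem exists_int_cocycle {F : Type*} [Field F] (a : F) (ha : a ≠ 0) :
    ∃ σ : ℤ → F, σ 1 = 1 ∧ ∀ j k, σ (j + k) = σ j + a ^ j * σ k := by
  by_cases h1 : a = 1
  · exact ⟨fun k => k, by simp, by simp [h1]⟩
  · have h2 : a - 1 ≠ 0 := sub_ne_zero.2 h1
    refine ⟨fun k => (a ^ k - 1) / (a - 1), by simp [h2], fun j k => ?_⟩
    simp only [zpow_add₀ ha]
    field_simp
    ring

/-- The map `g ↦ (c g, σ (e g))` is a crossed homomorphism to `𝔽_p ^ (n + 1)` on which `g` acts by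
the scalar `a ^ e g`. Because the action is scalar, the zero set of any linear form composed with it
is a subgroup. -/
theorem ZnMappingTorus.lt_rank_of_scalar_mod {p : ℕ} [Fact p.Prime] {a : ZMod p} (ha : a ≠ 0)
    (h : ∀ x i, ((φ x i : ℤ) : ZMod p) = a * (x i : ℤ)) :
    n < Group.rank (ZnMappingTorus φ) := by
  classical
  obtain ⟨σ, hσ1, hσ⟩ := exists_int_cocycle a ha
  have hσ0 : σ 0 = 0 := by simpa using hσ 0 0
  let c : ZnMappingTorus φ → Fin n → ZMod p := fun g i =>
    ((Multiplicative.toAdd g.left i : ℤ) : ZMod p)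
  let e : ZnMappingTorus φ → ℤ := fun g => Multiplicative.toAdd g.right
  have hpow : ∀ (k : ℤ) (x : Multiplicative (Fin n → ℤ)) (i : Fin n),
      ((Multiplicative.toAdd (((AddEquiv.toMultiplicative φ :
        MulAut (Multiplicative (Fin n → ℤ))) ^ k) x) i : ℤ) : ZMod p) =
        a ^ k * (Multiplicative.toAdd x i : ℤ) := by
    intro k
    induction k using Int.induction_on with
    | zero => simp
    | succ k ih =>
      intro x i
      rw [zpow_add_one, MulAut.mul_apply, ih, zpow_add_one₀ ha, mul_assoc]
      congr 1
      exact h _ i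
    | pred k ih =>
      intro x i
      have h1 := ih (((AddEquiv.toMultiplicative φ : MulAut (Multiplicative (Fin n → ℤ)))⁻¹) x) i
      rw [zpow_sub_one, MulAut.mul_apply, h1, zpow_sub_one₀ ha, mul_assoc]
      congr 1
      rw [eq_inv_mul_iff_mul_eq₀ ha]
      refine (h _ i).symm.trans ?_
      congr 2
      exact congrFun (φ.apply_symm_apply _) i
  have hc : ∀ g g' i, c (g * g') i = c g i + a ^ e g * c g' i := by
    intro g g' i
    simp only [c, SemidirectProduct.mul_left, toAdd_mul, Pi.add_apply, Int.cast_add]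
    congr 1
    exact hpow _ _ i
  have he : ∀ g g', e (g * g') = e g + e g' := fun g g' => rfl
  by_contra hlt
  obtain ⟨S, hS, hcl⟩ := Group.rank_spec (ZnMappingTorus φ)
  let δ : ZnMappingTorus φ → ((Fin n → ZMod p) × ZMod p) →ₗ[ZMod p] ZMod p := fun g =>
    { toFun := fun l => ∑ i, c g i * l.1 i + σ (e g) * l.2
      map_add' := fun l l' => by
        simp only [Prod.fst_add, Pi.add_apply, mul_add, Finset.sum_add_distrib, Prod.snd_add]
        ring
      map_smul' := fun r l => by
        simp only [Prod.smul_fst, Pi.smul_apply, smul_eq_mul, Prod.smul_snd, RingHom.id_apply,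
          mul_add, Finset.mul_sum]
        congr 1
        · exact Finset.sum_congr rfl fun i _ => by ring
        · ring }
  have hδ : ∀ g g' l, δ (g * g') l = δ g l + a ^ e g * δ g' l := by
    intro g g' l
    simp only [δ, LinearMap.coe_mk, AddHom.coe_mk, hc, he, hσ, add_mul, Finset.sum_add_distrib,
      mul_add, Finset.mul_sum, mul_assoc]
    ring
  -- At most `n` generators impose at most `n` linear conditions on the `n + 1` coefficients of a
  -- form.
  have hker : LinearMap.ker (LinearMap.pi fun g : S => δ g) ≠ ⊥ := by
    apply LinearMap.ker_ne_bot_of_finrank_lt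
    simp
    omega
  obtain ⟨l, hl, hl0⟩ := Submodule.exists_mem_ne_zero_of_ne_bot hker
  have h1 : ∀ l, δ 1 l = 0 := fun l => by simpa [e] using hδ 1 1 l
  let H : Subgroup (ZnMappingTorus φ) :=
    { carrier := {g | δ g l = 0}
      mul_mem' := fun {g g'} hg hg' => by
        simp only [Set.mem_ofPred_eq] at *
        rw [hδ, hg, hg', mul_zero, add_zero]
      one_mem' := h1 l
      inv_mem' := fun {g} hg => by
        simp only [Set.mem_ofPred_eq] at *
        have := hδ g⁻¹ g l
        rw [inv_mul_cancel, h1, hg, mul_zero, add_zero] at this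
        exact this.symm }
  have hH : H = ⊤ := by
    rw [eq_top_iff, ← hcl, Subgroup.closure_le]
    intro g hg
    exact congrFun (LinearMap.mem_ker.1 hl) ⟨g, hg⟩
  have hall : ∀ g, δ g l = 0 := fun g => by
    have : g ∈ H := by rw [hH]; trivial
    exact this
  refine hl0 (Prod.ext (funext fun i => ?_) ?_)
  · have := hall (fibre φ (Multiplicative.ofAdd (Pi.single i 1)))
    simpa [δ, c, e, fibre, hσ0, Pi.single_apply] using this
  · have := hall (stable φ)
    simpa [δ, c, e, stable, hσ1] using this

end

/-! ### Two-generated mapping tori of `ℤ²` -/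

/-- The Euclidean algorithm on the images in `ℤ`, lifted to Nielsen moves on the pair. -/
theorem Subgroup.exists_closure_pair_eq_of_hom_int {G : Type*} [Group G] (ρ : G →* Multiplicative ℤ)
    (g h : G) : ∃ g' h' : G, Subgroup.closure {g', h'} = Subgroup.closure {g, h} ∧ ρ g' = 1 := by
  induction hk : (Multiplicative.toAdd (ρ g)).natAbs using Nat.strong_induction_on generalizing g h with
  | _ k ih =>
    subst hk
    by_cases h0 : Multiplicative.toAdd (ρ g) = 0
    · exact ⟨g, h, rfl, h0⟩
    set q := Multiplicative.toAdd (ρ h) / Multiplicative.toAdd (ρ g)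
    have hr : Multiplicative.toAdd (ρ (h * g ^ (-q))) =
        Multiplicative.toAdd (ρ h) % Multiplicative.toAdd (ρ g) := by
      rw [map_mul, map_zpow, toAdd_mul, toAdd_zpow, smul_eq_mul]
      have := Int.emod_add_mul_ediv (Multiplicative.toAdd (ρ h)) (Multiplicative.toAdd (ρ g))
      linarith
    obtain ⟨g', h', hcl, hg'⟩ := ih _ (by
      have h1 := Int.emod_nonneg (Multiplicative.toAdd (ρ h)) h0
      have h2 := Int.emod_lt_abs (Multiplicative.toAdd (ρ h)) h0
      rw [hr]
      rw [Int.abs_eq_natAbs] at h2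
      omega) (h * g ^ (-q)) g rfl
    refine ⟨g', h', hcl.trans (le_antisymm ?_ ?_), hg'⟩
    · rw [Subgroup.closure_le]
      have hg : g ∈ Subgroup.closure {g, h} := Subgroup.subset_closure (by simp)
      have hh : h ∈ Subgroup.closure {g, h} := Subgroup.subset_closure (by simp)
      rintro _ (rfl | rfl)
      · exact mul_mem hh (zpow_mem hg _)
      · exact hg
    · rw [Subgroup.closure_le]
      have hg : g ∈ Subgroup.closure {h * g ^ (-q), g} := Subgroup.subset_closure (by simp)
      have hh : h * g ^ (-q) ∈ Subgroup.closure {h * g ^ (-q), g} := Subgroup.subset_closure (by simp)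
      rintro _ (rfl | rfl)
      · exact hg
      · have := mul_mem hh (zpow_mem hg q)
        simpa using this

/-- Cayley–Hamilton, with `t` the trace and `ε` the determinant. It makes the span of `u` and `φ u`
invariant under both `φ` and its inverse. -/
theorem AddAut.exists_quadratic_relation (φ : AddAut (Fin 2 → ℤ)) :
    ∃ t ε : ℤ, ε * ε = 1 ∧ ∀ x, φ (φ x) = t • φ x - ε • x := by
  let e : (Fin 2 → ℤ) ≃ₗ[ℤ] (Fin 2 → ℤ) := φ.toIntLinearEquiv
  let A := LinearMap.toMatrix' (e : (Fin 2 → ℤ) →ₗ[ℤ] (Fin 2 → ℤ))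
  have hA : ∀ x, φ x = A.mulVec x := fun x => by
    rw [LinearMap.toMatrix'_mulVec]; rfl
  refine ⟨A.trace, A.det, Int.isUnit_mul_self ?_, fun x => ?_⟩
  · rw [LinearMap.det_toMatrix']
    exact e.isUnit_det'
  · ext i
    rw [hA (φ x), hA x]
    fin_cases i <;>
    · simp [Matrix.mulVec, dotProduct, Fin.sum_univ_two, Matrix.det_fin_two, Matrix.trace]
      ring

/-- One generator can be moved into the fibre, as `u`; call the other `τ`. The span of `u, φ u` is
normal, so every element is a member of it times a power of `τ`. As `τ` has nonzero exponent, an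
element of the fibre involves only `τ ^ 0`. -/
theorem ZnMappingTorus.exists_closure_pair_eq_top (φ : AddAut (Fin 2 → ℤ))
    (h : Group.rank (ZnMappingTorus φ) ≤ 2) :
    ∃ u : Fin 2 → ℤ, AddSubgroup.closure {u, φ u} = ⊤ := by
  classical
  obtain ⟨S, hS, hcl⟩ := Group.rank_spec (ZnMappingTorus φ)
  obtain ⟨g, g', hsub⟩ : ∃ g g', S ⊆ {g, g'} := by
    rcases (Nat.le_succ_iff.1 (hS ▸ h) : S.card ≤ 1 ∨ S.card = 2) with h1 | h2
    · obtain ⟨g, hg⟩ := Finset.card_le_one_iff_subset_singleton.1 h1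
      exact ⟨g, g, by simpa using hg⟩
    · obtain ⟨g, g', -, rfl⟩ := Finset.card_eq_two.1 h2
      exact ⟨g, g', subset_rfl⟩
  have htop : Subgroup.closure {g, g'} = ⊤ := by
    rw [eq_top_iff, ← hcl]
    refine Subgroup.closure_mono fun x hx => ?_
    simpa using hsub hx
  obtain ⟨y, τ, hyτ, hy⟩ := Subgroup.exists_closure_pair_eq_of_hom_int SemidirectProduct.rightHom g g'
  rw [htop] at hyτ
  have hy' : y = fibre φ y.left := by
    have h1 : y.right = 1 := hy
    conv_lhs => rw [eq_fibre_mul_stable_zpow φ y]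
    simp [h1]
  set u : Fin 2 → ℤ := Multiplicative.toAdd y.left with hu
  refine ⟨u, ?_⟩
  set L := AddSubgroup.closure {u, φ u} with hL
  have huL : u ∈ L := AddSubgroup.subset_closure (by simp)
  have huL' : φ u ∈ L := AddSubgroup.subset_closure (by simp)
  obtain ⟨t, ε, hε, hrel⟩ := AddAut.exists_quadratic_relation φ
  have hφL : ∀ x ∈ L, φ x ∈ L := by
    have : L ≤ L.comap (φ : (Fin 2 → ℤ) →+ (Fin 2 → ℤ)) := by
      conv_lhs => rw [hL]
      rw [AddSubgroup.closure_le]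
      rintro _ (rfl | rfl)
      · exact huL'
      · change φ (φ u) ∈ L
        rw [hrel]
        exact L.sub_mem (L.zsmul_mem huL' _) (L.zsmul_mem huL _)
    exact this
  have hφL' : ∀ x ∈ L, φ.symm x ∈ L := fun x hx => by
    have h1 := hrel (φ.symm (φ.symm x))
    rw [φ.apply_symm_apply, φ.apply_symm_apply] at h1
    have h2 : φ.symm x = ε • (t • x - φ x) := by
      have := hrel (φ.symm x)
      rw [φ.apply_symm_apply] at this
      rw [this, sub_sub_cancel, smul_smul, hε, one_smul]
    rw [h2]
    exact L.zsmul_mem (L.sub_mem (L.zsmul_mem hx _) (hφL _ hx)) _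
  let N : Subgroup (ZnMappingTorus φ) := (AddSubgroup.toSubgroup L).map (fibre φ)
  have hstab : ∀ x ∈ N, stable φ * x * (stable φ)⁻¹ ∈ N := by
    rintro _ ⟨x, hx, rfl⟩
    exact ⟨Multiplicative.ofAdd (φ (Multiplicative.toAdd x)), hφL _ hx,
      (stable_mul_fibre_mul_inv φ (Multiplicative.toAdd x)).symm⟩
  have hstab' : ∀ x ∈ N, (stable φ)⁻¹ * x * stable φ ∈ N := by
    rintro _ ⟨x, hx, rfl⟩
    refine ⟨Multiplicative.ofAdd (φ.symm (Multiplicative.toAdd x)), hφL' _ hx, ?_⟩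
    have := stable_mul_fibre_mul_inv φ (φ.symm (Multiplicative.toAdd x))
    rw [φ.apply_symm_apply, ofAdd_toAdd] at this
    rw [← this]
    group
  have hN : N.Normal := by
    rw [← Subgroup.normalizer_eq_top_iff, eq_top_iff]
    have hst : stable φ ∈ Subgroup.normalizer (N : Set (ZnMappingTorus φ)) := by
      rw [Subgroup.mem_normalizer_iff]
      refine fun x => ⟨hstab x, fun hx => ?_⟩
      have := hstab' _ hx
      convert this using 1
      group
    intro g _
    rw [eq_fibre_mul_stable_zpow φ g]
    refine mul_mem ?_ (zpow_mem hst _)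
    rw [Subgroup.mem_normalizer_iff]
    intro x
    have hcomm : ∀ a b, fibre φ a * fibre φ b * (fibre φ a)⁻¹ = fibre φ b := fun a b => by
      rw [← map_mul, mul_comm, map_mul, mul_inv_cancel_right]
    constructor
    · rintro ⟨z, hz, rfl⟩
      exact ⟨z, hz, (hcomm _ _).symm⟩
    · rintro ⟨z, hz, hzx⟩
      refine ⟨z, hz, ?_⟩
      have h1 : x = (fibre φ g.left)⁻¹ * fibre φ z * fibre φ g.left := by rw [hzx]; group
      rw [h1, ← map_inv]
      conv_lhs => rw [← hcomm g.left⁻¹ z]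
      rw [map_inv, inv_inv]
  have hsup : N ⊔ Subgroup.zpowers τ = ⊤ := by
    rw [eq_top_iff, ← hyτ, Subgroup.closure_le]
    rintro _ (rfl | rfl)
    · exact Subgroup.mem_sup_left (by rw [hy']; exact ⟨_, huL, rfl⟩)
    · exact Subgroup.mem_sup_right (Subgroup.mem_zpowers _)
  have hdec : ∀ g : ZnMappingTorus φ, ∃ l ∈ L, ∃ i : ℤ,
      fibre φ (Multiplicative.ofAdd l) * τ ^ i = g := fun g => by
    have : g ∈ N ⊔ Subgroup.zpowers τ := by rw [hsup]; trivial
    obtain ⟨_, ⟨l, hl, rfl⟩, _, ⟨i, rfl⟩, h⟩ := Subgroup.mem_sup_of_normal_left.1 this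
    exact ⟨_, hl, i, h⟩
  have hright : ∀ l (i : ℤ), Multiplicative.toAdd
      (SemidirectProduct.rightHom (fibre φ (Multiplicative.ofAdd l) * τ ^ i)) =
        i * Multiplicative.toAdd τ.right := fun l i => by
    rw [map_mul, map_zpow]
    simp [fibre]
  have hk : Multiplicative.toAdd τ.right ≠ 0 := fun h0 => by
    obtain ⟨l, -, i, h⟩ := hdec (stable φ)
    have := hright l i
    rw [h, h0] at this
    simp [stable] at this
  rw [eq_top_iff]
  intro x _
  obtain ⟨l, hl, i, h⟩ := hdec (fibre φ (Multiplicative.ofAdd x))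
  have hi := hright l i
  rw [h] at hi
  have hi0 : i = 0 := by
    have : i * Multiplicative.toAdd τ.right = 0 := by rw [← hi]; simp [fibre]
    exact (mul_eq_zero.1 this).resolve_right hk
  rw [hi0, zpow_zero, mul_one] at h
  have := SemidirectProduct.inl_injective h
  rwa [← Multiplicative.ofAdd.injective this]

/-! ### Bounding representations of `±1` by the binary form -/

/-- The determinant of `(v, A v)` for `A = !![a, b; c, d]` and `v = (x, y)`. -/
def cyclicForm (a b c d x y : ℤ) : ℤ := x * (c * x + d * y) - y * (a * x + b * y)

section
variable {a b c d : ℤ}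

/-- The form factors as `y * ((d - a) * x - b * y)`, so both factors are `±1`. If `d = a`, then `x`
plays no role and is taken to be `0`. -/
theorem exists_cyclicForm_le_of_lower_eq_zero {x y : ℤ}
    (hxy : |cyclicForm a b 0 d x y| = 1) :
    ∃ x y : ℤ, |cyclicForm a b 0 d x y| = 1 ∧ |x| ≤ 1 + |b| ∧ |y| ≤ 1 := by
  have hQ : cyclicForm a b 0 d x y = y * ((d - a) * x - b * y) := by
    unfold cyclicForm; ring
  rw [hQ, ← Int.isUnit_iff_abs_eq, IsUnit.mul_iff, Int.isUnit_iff_abs_eq,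
    Int.isUnit_iff_abs_eq] at hxy
  obtain ⟨hy, hx⟩ := hxy
  by_cases hda : d = a
  · refine ⟨0, y, ?_, by simp; positivity, hy.le⟩
    have h1 : cyclicForm a b 0 d 0 y = y * ((d - a) * x - b * y) := by
      rw [hda]; unfold cyclicForm; ring
    rw [h1, abs_mul, hy, hx, mul_one]
  · refine ⟨x, y, by rw [hQ, abs_mul, hy, hx, mul_one], ?_, hy.le⟩
    have h1 : |(d - a) * x| ≤ 1 + |b| := by
      have h2 := abs_add_le ((d - a) * x - b * y) (b * y)
      rw [sub_add_cancel, hx, abs_mul b, hy, mul_one] at h2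
      exact h2
    rw [abs_mul] at h1
    have h3 : 1 ≤ |d - a| := Int.one_le_abs (sub_ne_zero.2 hda)
    nlinarith [abs_nonneg x]

theorem Int.abs_le_abs_of_sq_eq_sq_add {y z m : ℤ} (hm : m ≠ 0) (h : z ^ 2 = y ^ 2 + m) :
    |y| ≤ |m| := by
  have h1 : m = (|z| - |y|) * (|z| + |y|) := by
    have := sq_abs z
    have := sq_abs y
    linarith [sq_sub_sq |z| |y|, mul_comm (|z| - |y|) (|z| + |y|)]
  have h2 : 1 ≤ abs (|z| - |y|) := Int.one_le_abs fun h => hm (by rw [h1, h, zero_mul])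
  have h3 : 0 ≤ |z| + |y| := by positivity
  calc |y| ≤ 1 * (|z| + |y|) := by linarith [abs_nonneg z]
    _ ≤ abs (|z| - |y|) * (|z| + |y|) := mul_le_mul_of_nonneg_right h2 h3
    _ = |m| := by
      conv_rhs => rw [h1, abs_mul, abs_of_nonneg h3]

/-- The matrix and its adjugate preserve the form up to sign, so minimality compares `y` with the
second coordinates of both images. These have sum `t * y` and product `ε * y ^ 2 - m`, where `|m| =
|c|`, which gives `|t| * y ^ 2 ≤ |(ε + 1) * y ^ 2 - m|`. The few pairs `(t, ε)` for which this is
not enough are settled by the discriminant identity for `X ^ 2`. -/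
theorem abs_le_two_mul_abs_of_minimal (hc : c ≠ 0) (hdet : |a * d - b * c| = 1) {x y : ℤ}
    (hxy : |cyclicForm a b c d x y| = 1)
    (hmin : ∀ x' y' : ℤ, |cyclicForm a b c d x' y'| = 1 → |y| ≤ |y'|) : |y| ≤ 2 * |c| := by
  have hc1 : 1 ≤ |c| := Int.one_le_abs hc
  obtain ⟨m, hm⟩ : ∃ m, m = c * cyclicForm a b c d x y := ⟨_, rfl⟩
  have hmc : |m| = |c| := by rw [hm, abs_mul, hxy, mul_one]
  have hm0 : m ≠ 0 := by rw [← abs_pos, hmc]; omega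
  suffices y ^ 2 ≤ 4 * m ^ 2 by
    have h1 : y ^ 2 ≤ (2 * m) ^ 2 := by linarith
    have := sq_le_sq.1 h1
    rwa [abs_mul, hmc, abs_two] at this
  have hm2 : |m| ≤ m ^ 2 := by
    rw [← sq_abs]
    nlinarith
  have hml := neg_abs_le m
  have hmr := le_abs_self m
  have h1 : y ^ 2 ≤ (c * x + d * y) ^ 2 := by
    refine sq_le_sq.2 (hmin (a * x + b * y) _ ?_)
    have e : cyclicForm a b c d (a * x + b * y) (c * x + d * y) =
      (a * d - b * c) * cyclicForm a b c d x y := by unfold cyclicForm; ring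
    rw [e, abs_mul, hdet, hxy, one_mul]
  have h2 : y ^ 2 ≤ (-c * x + a * y) ^ 2 := by
    refine sq_le_sq.2 (hmin (d * x - b * y) _ ?_)
    have e : cyclicForm a b c d (d * x - b * y) (-c * x + a * y) =
      (a * d - b * c) * cyclicForm a b c d x y := by unfold cyclicForm; ring
    rw [e, abs_mul, hdet, hxy, one_mul]
  obtain ⟨t, ht⟩ : ∃ t, t = a + d := ⟨_, rfl⟩
  obtain ⟨ε, hε⟩ : ∃ ε, ε = a * d - b * c := ⟨_, rfl⟩
  obtain ⟨P, hP⟩ : ∃ P, P = (c * x + d * y) * (-c * x + a * y) := ⟨_, rfl⟩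
  have hP' : P = ε * y ^ 2 - m := by rw [hP, hε, hm]; unfold cyclicForm; ring
  obtain ⟨X, hX⟩ : ∃ X, X = 2 * c * x + (d - a) * y := ⟨_, rfl⟩
  have hX' : X ^ 2 = (t ^ 2 - 4 * ε) * y ^ 2 + 4 * m := by
    rw [hX, ht, hε, hm]; unfold cyclicForm; ring
  have h3 : (t * y ^ 2) ^ 2 ≤ (P + y ^ 2) ^ 2 := by
    have := mul_nonneg (sub_nonneg.2 h1) (sub_nonneg.2 h2)
    have e : ((c * x + d * y) ^ 2 - y ^ 2) * ((-c * x + a * y) ^ 2 - y ^ 2) =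
        (P + y ^ 2) ^ 2 - (t * y ^ 2) ^ 2 := by rw [hP, ht]; ring
    linarith
  have h4 := sq_le_sq.1 h3
  rw [abs_mul, abs_sq, hP'] at h4
  have hy := sq_nonneg y
  rcases (abs_eq zero_le_one).1 hdet with h | h
  · rw [← hε] at h
    subst h
    have h5 : |1 * y ^ 2 - m + y ^ 2| ≤ 2 * y ^ 2 + |m| := by
      rw [abs_le]; constructor <;> linarith
    by_cases h6 : 3 ≤ |t|
    · have h7 := mul_le_mul_of_nonneg_right h6 hy
      linarith
    by_cases h7 : |t| ≤ 1
    · have : t ^ 2 ≤ 1 := by rw [← sq_abs]; nlinarith [abs_nonneg t]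
      have h8 := mul_le_mul_of_nonneg_right this hy
      linarith [sq_nonneg X]
    · have h8 : |t| = 2 := by omega
      have h9 : t ^ 2 = 4 := by rw [← sq_abs, h8]; norm_num
      have h10 : 0 < m := by
        rw [h9] at hX'
        have := sq_nonneg X
        omega
      rw [h8] at h4
      rcases le_abs.1 h4 with h11 | h11 <;> linarith
  · rw [← hε] at h
    subst h
    have h5 : |-1 * y ^ 2 - m + y ^ 2| = |m| := by rw [← abs_neg m]; congr 1; ring
    rw [h5] at h4
    by_cases h6 : t = 0
    · subst h6
      have h7 : a = -d := by linarith
      have h8 : (c * x + d * y) ^ 2 = y ^ 2 + m := by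
        have : X = 2 * (c * x + d * y) := by rw [hX, h7]; ring
        rw [this] at hX'
        linarith
      have h9 := Int.abs_le_abs_of_sq_eq_sq_add hm0 h8
      have h10 := sq_le_sq.2 h9
      linarith [sq_nonneg m]
    · have h7 := mul_le_mul_of_nonneg_right (Int.one_le_abs h6) hy
      linarith

/-- If `cyclicForm` represents `±1`, it does so in an explicit box. -/
theorem exists_cyclicForm_le {N : ℤ} (hN : 1 ≤ N) (ha : |a| ≤ N) (hb : |b| ≤ N) (hc : |c| ≤ N)
    (hd : |d| ≤ N) (hdet : |a * d - b * c| = 1) (h : ∃ x y : ℤ, |cyclicForm a b c d x y| = 1) :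
    ∃ x y : ℤ, |cyclicForm a b c d x y| = 1 ∧ |x| ≤ 5 * N ^ 2 + N + 1 ∧
      |y| ≤ 5 * N ^ 2 + N + 1 := by
  classical
  by_cases hc0 : c = 0
  · subst hc0
    obtain ⟨x, y, hxy⟩ := h
    obtain ⟨x, y, h, hx, hy⟩ := exists_cyclicForm_le_of_lower_eq_zero hxy
    exact ⟨x, y, h, by nlinarith, by nlinarith⟩
  have hex : ∃ n : ℕ, ∃ x y : ℤ, |cyclicForm a b c d x y| = 1 ∧ y.natAbs = n := by
    obtain ⟨x, y, hxy⟩ := h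
    exact ⟨_, x, y, hxy, rfl⟩
  obtain ⟨x, y, hxy, hy⟩ := Nat.find_spec hex
  have hyc := abs_le_two_mul_abs_of_minimal hc0 hdet hxy fun x' y' h' => by
    rw [Int.abs_eq_natAbs, Int.abs_eq_natAbs, hy]
    exact_mod_cast Nat.find_min' hex ⟨x', y', h', rfl⟩
  have hyN : |y| ≤ 2 * N := by linarith
  refine ⟨x, y, hxy, ?_, by nlinarith⟩
  -- Completing the square turns the bound on `y` into one on `x`, as `c ≠ 0`.
  have hX : (2 * c * x + (d - a) * y) ^ 2 =
      ((a + d) ^ 2 - 4 * (a * d - b * c)) * y ^ 2 + 4 * (c * cyclicForm a b c d x y) := by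
    unfold cyclicForm; ring
  have h1 : |c * cyclicForm a b c d x y| ≤ N := by rw [abs_mul, hxy, mul_one]; exact hc
  have h2 : (a + d) ^ 2 - 4 * (a * d - b * c) ≤ 8 * N ^ 2 := by
    have h3 : (a + d) ^ 2 ≤ (2 * N) ^ 2 := by
      refine sq_le_sq' ?_ ?_ <;> linarith [abs_le.1 ha, abs_le.1 hd]
    have h4 := (abs_le.1 hdet.le).1
    nlinarith
  have h3 : y ^ 2 ≤ (2 * N) ^ 2 := by
    refine sq_le_sq.2 ?_
    rwa [abs_of_nonneg (by linarith : 0 ≤ 2 * N)]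
  have h4 : |2 * c * x + (d - a) * y| ≤ 6 * N ^ 2 := by
    refine abs_le_of_sq_le_sq ?_ (by positivity)
    rw [hX]
    have h5 := (abs_le.1 h1).2
    have h6 := mul_le_mul_of_nonneg_right h2 (sq_nonneg y)
    have h7 := mul_le_mul_of_nonneg_left h3 (by positivity : 0 ≤ 8 * N ^ 2)
    have h8 : N ≤ N ^ 4 := le_self_pow₀ hN (by norm_num)
    linarith
  have h5 : |(d - a) * y| ≤ 2 * N * (2 * N) := by
    rw [abs_mul]
    refine mul_le_mul ?_ hyN (abs_nonneg _) (by linarith)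
    rw [abs_le]
    constructor <;> linarith [abs_le.1 ha, abs_le.1 hd]
  have h6 : |2 * c * x| ≤ 10 * N ^ 2 := by
    have := abs_sub (2 * c * x + (d - a) * y) ((d - a) * y)
    rw [add_sub_cancel_right] at this
    linarith
  rw [abs_mul, abs_mul, abs_two] at h6
  have h7 : 1 ≤ |c| := Int.one_le_abs hc0
  nlinarith [abs_nonneg x]

end

/-! ### Primitive recursive integer arithmetic -/

theorem Int.encode_natCast (m : ℕ) : Encodable.encode (m : ℤ) = 2 * m := rfl

theorem Int.encode_negSucc (m : ℕ) : Encodable.encode (Int.negSucc m) = 2 * m + 1 := rfl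

theorem Int.natAbs_eq_encode (z : ℤ) : z.natAbs = (Encodable.encode z + 1) / 2 := by
  cases z with
  | ofNat m => rw [Int.ofNat_eq_natCast, Int.encode_natCast]; simp; omega
  | negSucc m => rw [Int.encode_negSucc, Int.natAbs_negSucc]; omega

theorem Int.toNat_eq_encode (z : ℤ) :
    z.toNat = if Encodable.encode z % 2 = 0 then Encodable.encode z / 2 else 0 := by
  cases z with
  | ofNat m => rw [Int.ofNat_eq_natCast, Int.encode_natCast]; simp
  | negSucc m => rw [Int.encode_negSucc, if_neg (by omega), Int.toNat_negSucc]

namespace Primrec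

theorem int_natAbs : Primrec Int.natAbs :=
  (nat_div.comp (succ.comp Primrec.encode) (const 2)).of_eq fun z => (Int.natAbs_eq_encode z).symm

theorem int_toNat : Primrec Int.toNat :=
  (Primrec.ite (Primrec.eq.comp (nat_mod.comp Primrec.encode (const 2)) (const 0))
    (nat_div.comp Primrec.encode (const 2)) (const 0)).of_eq fun z => (Int.toNat_eq_encode z).symm

theorem int_neg_toNat : Primrec fun z : ℤ => (-z).toNat :=
  (nat_sub.comp int_natAbs int_toNat).of_eq fun z => by omega

/-- Addition, negation and multiplication reduce to this by splitting integers into positive and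
negative parts. -/
theorem int_subNat : Primrec₂ fun m n : ℕ => (m : ℤ) - n := by
  refine encode_iff.1 ((Primrec.ite (nat_le.comp snd fst)
    (nat_mul.comp (const 2) (nat_sub.comp fst snd))
    (nat_sub.comp (nat_mul.comp (const 2) (nat_sub.comp snd fst)) (const 1))).of_eq
    fun p => ?_)
  obtain ⟨m, n⟩ := p
  change (if n ≤ m then 2 * (m - n) else 2 * (n - m) - 1) = Encodable.encode ((m : ℤ) - n)
  split_ifs with h
  · rw [← Int.ofNat_sub h, Int.encode_natCast]
  · rw [show (m : ℤ) - n = Int.negSucc (n - m - 1) by omega, Int.encode_negSucc]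
    omega

theorem int_add : Primrec₂ ((· + ·) : ℤ → ℤ → ℤ) :=
  (int_subNat.comp (nat_add.comp (int_toNat.comp fst) (int_toNat.comp snd))
    (nat_add.comp (int_neg_toNat.comp fst) (int_neg_toNat.comp snd))).of_eq fun _ => by
      push_cast
      omega

theorem int_neg : Primrec (Neg.neg : ℤ → ℤ) :=
  (int_subNat.comp int_neg_toNat int_toNat).of_eq fun z => by omega

theorem int_sub : Primrec₂ ((· - ·) : ℤ → ℤ → ℤ) :=
  (int_add.comp fst (int_neg.comp snd)).of_eq fun _ => (sub_eq_add_neg _ _).symm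

theorem int_mul : Primrec₂ ((· * ·) : ℤ → ℤ → ℤ) :=
  (int_subNat.comp
    (nat_add.comp (nat_mul.comp (int_toNat.comp fst) (int_toNat.comp snd))
      (nat_mul.comp (int_neg_toNat.comp fst) (int_neg_toNat.comp snd)))
    (nat_add.comp (nat_mul.comp (int_toNat.comp fst) (int_neg_toNat.comp snd))
      (nat_mul.comp (int_neg_toNat.comp fst) (int_toNat.comp snd)))).of_eq fun p => by
      have h1 : p.1 = p.1.toNat - (-p.1).toNat := by omega
      have h2 : p.2 = p.2.toNat - (-p.2).toNat := by omega
      conv_rhs => rw [h1, h2]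
      push_cast
      ring

end Primrec

theorem PrimrecPred.exists_lt_fun {α : Type*} [Primcodable α] {R : α → ℕ → Prop} {f : α → ℕ}
    (hR : PrimrecRel R) (hf : Primrec f) : PrimrecPred fun a => ∃ x < f a, R a x :=
  (hR.swap.exists_mem_list.comp (Primrec.list_range.comp hf) Primrec.id).of_eq (by simp)

theorem PrimrecPred.forall_lt_fun {α : Type*} [Primcodable α] {R : α → ℕ → Prop} {f : α → ℕ}
    (hR : PrimrecRel R) (hf : Primrec f) : PrimrecPred fun a => ∀ x < f a, R a x :=
  (hR.swap.forall_mem_list.comp (Primrec.list_range.comp hf) Primrec.id).of_eq (by simp)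

/-! ### The decision procedure on lists of rows -/

/-- The entry `(i, j)` of a matrix given as the list of its rows, `0` outside the matrix. -/
def rowsEntry (L : List (List ℤ)) (i j : ℕ) : ℤ := (L.getD i []).getD j 0

theorem Primrec.rowsEntry {α : Type*} [Primcodable α] {L : α → List (List ℤ)} {i j : α → ℕ}
    (hL : Primrec L) (hi : Primrec i) (hj : Primrec j) :
    Primrec fun a => rowsEntry (L a) (i a) (j a) :=
  (Primrec.list_getD 0).comp ((Primrec.list_getD []).comp hL hi) hj

theorem Primrec.cyclicForm {α : Type*} [Primcodable α] {a b c d x y : α → ℤ} (ha : Primrec a)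
    (hb : Primrec b) (hc : Primrec c) (hd : Primrec d) (hx : Primrec x) (hy : Primrec y) :
    Primrec fun s => cyclicForm (a s) (b s) (c s) (d s) (x s) (y s) :=
  int_sub.comp (int_mul.comp hx (int_add.comp (int_mul.comp hc hx) (int_mul.comp hd hy)))
    (int_mul.comp hy (int_add.comp (int_mul.comp ha hx) (int_mul.comp hb hy)))

/-- Bound for the codes of the coordinates of a cyclic vector. -/
def cyclicBound (N : ℕ) : ℕ := 2 * (5 * (N * N) + N + 1) + 1

/-- A bounded search for a cyclic vector of a two by two matrix. -/
def HasSmallCyclicVector (L : List (List ℤ)) : Prop :=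
  ∃ k < cyclicBound (Encodable.encode L), ∃ l < cyclicBound (Encodable.encode L),
    (cyclicForm (rowsEntry L 0 0) (rowsEntry L 0 1) (rowsEntry L 1 0) (rowsEntry L 1 1)
      (Denumerable.ofNat ℤ k) (Denumerable.ofNat ℤ l)).natAbs = 1

/-- A bounded search for a modulus `m + 2` for which a matrix is scalar. -/
def IsScalarModSmall (L : List (List ℤ)) : Prop :=
  ∃ m < 2 * Encodable.encode L + 1, ∀ i < L.length, ∀ j < L.length,
    (rowsEntry L i j - if i = j then rowsEntry L 0 0 else 0).natAbs % (m + 2) = 0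

open Primrec in
theorem primrecPred_hasSmallCyclicVector : PrimrecPred HasSmallCyclicVector := by
  have hB : Primrec fun L : List (List ℤ) => cyclicBound (Encodable.encode L) :=
    succ.comp (nat_mul.comp (const 2) (succ.comp (nat_add.comp (nat_mul.comp (const 5)
      (nat_mul.comp Primrec.encode Primrec.encode)) Primrec.encode)))
  refine PrimrecPred.exists_lt_fun ?_ hB
  refine PrimrecPred.exists_lt_fun ?_ (hB.comp fst)
  have h1 : Primrec fun p : (List (List ℤ) × ℕ) × ℕ => p.1.1 := fst.comp fst
  refine Primrec.eq.comp (int_natAbs.comp (Primrec.cyclicForm ?_ ?_ ?_ ?_ ?_ ?_)) (const 1)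
  · exact Primrec.rowsEntry h1 (const 0) (const 0)
  · exact Primrec.rowsEntry h1 (const 0) (const 1)
  · exact Primrec.rowsEntry h1 (const 1) (const 0)
  · exact Primrec.rowsEntry h1 (const 1) (const 1)
  · exact (Primrec.ofNat ℤ).comp (snd.comp fst)
  · exact (Primrec.ofNat ℤ).comp snd

open Primrec in
theorem primrecPred_isScalarModSmall : PrimrecPred IsScalarModSmall := by
  refine PrimrecPred.exists_lt_fun ?_ (succ.comp (nat_mul.comp (const 2) Primrec.encode))
  refine PrimrecPred.forall_lt_fun ?_ (list_length.comp fst)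
  refine PrimrecPred.forall_lt_fun ?_ (list_length.comp (fst.comp fst))
  have h1 : Primrec fun p : ((List (List ℤ) × ℕ) × ℕ) × ℕ => p.1.1.1 := fst.comp (fst.comp fst)
  have h2 : Primrec fun p : ((List (List ℤ) × ℕ) × ℕ) × ℕ => p.1.2 := snd.comp fst
  refine Primrec.eq.comp (nat_mod.comp (int_natAbs.comp (int_sub.comp
    (Primrec.rowsEntry h1 h2 snd) ?_)) (succ.comp (succ.comp (snd.comp (fst.comp fst))))) (const 0)
  exact Primrec.ite (Primrec.eq.comp h2 snd) (Primrec.rowsEntry h1 (const 0) (const 0)) (const 0)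

/-- The criterion for the mapping torus to have maximal rank, for the matrix as a list of rows. -/
def HasMaximalRank (L : List (List ℤ)) : Prop :=
  L.length ≤ 1 ∨ (L.length = 2 ∧ ¬ HasSmallCyclicVector L) ∨ (3 ≤ L.length ∧ IsScalarModSmall L)

open Primrec in
theorem primrecPred_hasMaximalRank : PrimrecPred HasMaximalRank :=
  (nat_le.comp list_length (const 1)).or
    (((Primrec.eq.comp list_length (const 2)).and primrecPred_hasSmallCyclicVector.not).or
      ((nat_le.comp (const 3) list_length).and primrecPred_isScalarModSmall))

theorem Encodable.encode_le_of_mem_list {α : Type*} [Encodable α] {a : α} {l : List α}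
    (h : a ∈ l) : Encodable.encode a ≤ Encodable.encode l := by
  induction l with
  | nil => simp at h
  | cons b l ih =>
    rw [Encodable.encode_list_cons]
    rcases List.mem_cons.1 h with rfl | h
    · exact (Nat.left_le_pair _ _).trans (Nat.le_succ _)
    · exact (ih h).trans ((Nat.right_le_pair _ _).trans (Nat.le_succ _))

/-! ### Correctness of the bounded searches -/

section
variable {n : ℕ} (A : Matrix (Fin n) (Fin n) ℤ)

theorem length_matrixRows : (matrixRows A).length = n := by simp [matrixRows]

theorem rowsEntry_matrixRows (i j : Fin n) : rowsEntry (matrixRows A) i j = A i j := by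
  simp [rowsEntry, matrixRows]

/-- The code of the whole input serves as a computable bound for its entries. -/
theorem natAbs_le_encode_matrixRows (i j : Fin n) :
    (A i j).natAbs ≤ Encodable.encode (matrixRows A) := by
  have h1 : (A i j).natAbs ≤ Encodable.encode (A i j) := by
    cases A i j with
    | ofNat m => rw [Int.ofNat_eq_natCast, Int.encode_natCast]; simp; omega
    | negSucc m => rw [Int.encode_negSucc, Int.natAbs_negSucc]; omega
  refine h1.trans ((Encodable.encode_le_of_mem_list (l := List.ofFn fun j => A i j) ?_).trans
    (Encodable.encode_le_of_mem_list ?_))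
  · exact (List.mem_ofFn' _ _).2 ⟨j, rfl⟩
  · exact (List.mem_ofFn' _ _).2 ⟨i, rfl⟩

theorem dvd_entriesGcd_iff (m : ℕ) : m ∣ entriesGcd A ↔ ∀ i j, (m : ℤ) ∣ A i j := by
  simp [entriesGcd, Finset.dvd_gcd_iff, Int.natCast_dvd]

theorem isScalarModSmall_matrixRows_iff (hn : 0 < n) :
    IsScalarModSmall (matrixRows A) ↔
      entriesGcd (A - (A ⟨0, hn⟩ ⟨0, hn⟩) • (1 : Matrix (Fin n) (Fin n) ℤ)) ≠ 1 := by
  have hentry : ∀ i j : Fin n, (rowsEntry (matrixRows A) i j -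
      if (i : ℕ) = j then rowsEntry (matrixRows A) 0 0 else 0) =
      (A - (A ⟨0, hn⟩ ⟨0, hn⟩) • (1 : Matrix (Fin n) (Fin n) ℤ)) i j := fun i j => by
    have h0 := rowsEntry_matrixRows A ⟨0, hn⟩ ⟨0, hn⟩
    rw [rowsEntry_matrixRows, Matrix.sub_apply, Matrix.smul_apply, Matrix.one_apply, h0]
    simp only [Fin.ext_iff]
    split_ifs <;> simp
  set B := A - (A ⟨0, hn⟩ ⟨0, hn⟩) • (1 : Matrix (Fin n) (Fin n) ℤ)
  have hmod : ∀ m : ℕ, (∀ i < (matrixRows A).length, ∀ j < (matrixRows A).length,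
      (rowsEntry (matrixRows A) i j -
        if i = j then rowsEntry (matrixRows A) 0 0 else 0).natAbs % (m + 2) = 0) ↔
      (m + 2) ∣ entriesGcd B := fun m => by
    rw [dvd_entriesGcd_iff, length_matrixRows]
    constructor
    · intro h i j
      have := h i i.2 j j.2
      rw [hentry, ← Nat.dvd_iff_mod_eq_zero] at this
      exact Int.natCast_dvd.2 this
    · intro h i hi j hj
      rw [← Nat.dvd_iff_mod_eq_zero, hentry ⟨i, hi⟩ ⟨j, hj⟩]
      exact Int.natCast_dvd.1 (h _ _)
  simp only [IsScalarModSmall, hmod]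
  constructor
  · rintro ⟨m, -, hm⟩ h1
    rw [h1, Nat.dvd_one] at hm
    omega
  · intro h
    by_cases h0 : entriesGcd B = 0
    -- For a scalar matrix every modulus works; `m = 0` stands for modulus `2`.
    · exact ⟨0, by omega, by rw [h0]; exact dvd_zero _⟩
    refine ⟨entriesGcd B - 2, ?_, by rw [Nat.sub_add_cancel (by omega)]⟩
    obtain ⟨i, j, hij⟩ : ∃ i j, B i j ≠ 0 := by
      by_contra! hB
      refine h0 (Nat.eq_zero_of_zero_dvd ((dvd_entriesGcd_iff B 0).2 fun i j => ?_))
      rw [hB]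
      exact dvd_zero _
    have h1 := Nat.le_of_dvd (Int.natAbs_pos.2 hij)
      (Int.natCast_dvd.1 ((dvd_entriesGcd_iff B _).1 dvd_rfl i j))
    have h2 := hentry i j
    have h3 := natAbs_le_encode_matrixRows A i j
    have h4 := natAbs_le_encode_matrixRows A ⟨0, hn⟩ ⟨0, hn⟩
    have h0 := rowsEntry_matrixRows A ⟨0, hn⟩ ⟨0, hn⟩
    rw [rowsEntry_matrixRows, h0] at h2
    split_ifs at h2 <;> omega

end

theorem hasSmallCyclicVector_matrixRows_iff (A : Matrix (Fin 2) (Fin 2) ℤ) (hA : |A.det| = 1) :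
    HasSmallCyclicVector (matrixRows A) ↔
      ∃ x y : ℤ, |cyclicForm (A 0 0) (A 0 1) (A 1 0) (A 1 1) x y| = 1 := by
  have e00 := rowsEntry_matrixRows A 0 0
  have e01 := rowsEntry_matrixRows A 0 1
  have e10 := rowsEntry_matrixRows A 1 0
  have e11 := rowsEntry_matrixRows A 1 1
  simp only [Fin.val_zero, Fin.val_one] at e00 e01 e10 e11
  simp only [HasSmallCyclicVector, e00, e01, e10, e11]
  constructor
  · rintro ⟨k, -, l, -, h⟩
    exact ⟨_, _, by rw [Int.abs_eq_natAbs, h]; rfl⟩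
  · intro h
    have hN : ∀ i j, |A i j| ≤ (Encodable.encode (matrixRows A) : ℤ) := fun i j => by
      rw [Int.abs_eq_natAbs]
      exact_mod_cast natAbs_le_encode_matrixRows A i j
    have hN1 : (1 : ℤ) ≤ Encodable.encode (matrixRows A) := by
      have : Encodable.encode (matrixRows A) ≠ 0 := by
        have := length_matrixRows A
        have h2 := Encodable.length_le_encode (matrixRows A)
        omega
      omega
    rw [Matrix.det_fin_two] at hA
    obtain ⟨x, y, h, hx, hy⟩ := exists_cyclicForm_le hN1 (hN 0 0) (hN 0 1) (hN 1 0) (hN 1 1) hA h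
    -- The code of `z` is at most `2 * |z|`, whence the shape of `cyclicBound`.
    have henc : ∀ z : ℤ, |z| ≤ 5 * (Encodable.encode (matrixRows A) : ℤ) ^ 2 +
        Encodable.encode (matrixRows A) + 1 →
        Encodable.encode z < cyclicBound (Encodable.encode (matrixRows A)) := fun z hz => by
      have h1 := Int.natAbs_eq_encode z
      have h2 : z.natAbs ≤ 5 * (Encodable.encode (matrixRows A) * Encodable.encode (matrixRows A)) +
          Encodable.encode (matrixRows A) + 1 := by
        rw [Int.abs_eq_natAbs, pow_two] at hz
        exact_mod_cast hz
      unfold cyclicBound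
      omega
    refine ⟨Encodable.encode x, henc x hx, Encodable.encode y, henc y hy, ?_⟩
    rw [Denumerable.ofNat_encode, Denumerable.ofNat_encode]
    rw [Int.abs_eq_natAbs] at h
    exact_mod_cast h

/-! ### The gcd criterion in an arbitrary basis -/

section
variable {n : ℕ} (φ : AddAut (Fin n → ℤ)) (b : Module.Basis (Fin n) ℤ (Fin n → ℤ))

theorem autMatrix_apply (i j : Fin n) : autMatrix b φ i j = b.repr (φ (b j)) i := by
  rw [autMatrix, LinearMap.toMatrix_apply]
  rfl

theorem repr_apply_eq_sum (x : Fin n → ℤ) (i : Fin n) :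
    b.repr (φ x) i = ∑ j, autMatrix b φ i j * b.repr x j := by
  have := LinearMap.toMatrix_mulVec_repr b b
    (φ.toIntLinearEquiv : (Fin n → ℤ) →ₗ[ℤ] (Fin n → ℤ)) x
  exact (congrFun this i).symm

/-- Off-diagonal entries come from a basis vector and a different coordinate; differences of
diagonal entries come from `b i + b 0` paired with `b.coord i - b.coord 0`. -/
theorem dvd_entriesGcd_of_forall_dvd (hn : 0 < n) {m : ℤ}
    (h : ∀ (v : Fin n → ℤ) (w : (Fin n → ℤ) →ₗ[ℤ] ℤ), w v = 0 → m ∣ w (φ v)) :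
    m.natAbs ∣ entriesGcd (autMatrix b φ -
      (autMatrix b φ ⟨0, hn⟩ ⟨0, hn⟩) • (1 : Matrix (Fin n) (Fin n) ℤ)) := by
  have hoff : ∀ i j, i ≠ j → m ∣ autMatrix b φ i j := fun i j hij => by
    rw [autMatrix_apply]
    exact h (b j) (b.coord i) (by simp [hij.symm])
  rw [dvd_entriesGcd_iff]
  intro i j
  rw [Int.natAbs_dvd]
  by_cases hij : i = j
  · subst hij
    by_cases h0 : i = ⟨0, hn⟩
    · simp [h0, -zsmul_eq_mul, -zsmul_one]
    · have h1 := h (b i + b ⟨0, hn⟩) (b.coord i - b.coord ⟨0, hn⟩) (by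
        simp [h0, Ne.symm h0])
      simp only [map_add, LinearMap.sub_apply, Module.Basis.coord_apply, ← autMatrix_apply] at h1
      have h2 := hoff _ _ h0
      have h3 := hoff _ _ (Ne.symm h0)
      have h4 : autMatrix b φ i i - autMatrix b φ ⟨0, hn⟩ ⟨0, hn⟩ =
          (autMatrix b φ i i - autMatrix b φ ⟨0, hn⟩ i +
            (autMatrix b φ i ⟨0, hn⟩ - autMatrix b φ ⟨0, hn⟩ ⟨0, hn⟩)) -
            autMatrix b φ i ⟨0, hn⟩ + autMatrix b φ ⟨0, hn⟩ i := by ring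
      simp only [Matrix.sub_apply, Matrix.smul_apply, Matrix.one_apply_eq, smul_eq_mul, mul_one]
      rw [h4]
      exact (h1.sub h2).add h3
  · simpa [hij, -zsmul_eq_mul, -zsmul_one] using hoff i j hij

theorem ZnMappingTorus.rank_eq_of_entriesGcd_ne_one (hn : 0 < n)
    (h : entriesGcd (autMatrix b φ -
      (autMatrix b φ ⟨0, hn⟩ ⟨0, hn⟩) • (1 : Matrix (Fin n) (Fin n) ℤ)) ≠ 1) :
    Group.rank (ZnMappingTorus φ) = n + 1 := by
  -- This covers gcd `0`, which every prime divides.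
  obtain ⟨p, hp, hpd⟩ := Nat.exists_prime_and_dvd h
  have := Fact.mk hp
  rw [dvd_entriesGcd_iff] at hpd
  set a := autMatrix b φ ⟨0, hn⟩ ⟨0, hn⟩
  have hcoord : ∀ x i, (p : ℤ) ∣ b.repr (φ x - a • x) i := fun x i => by
    have h1 : b.repr (φ x - a • x) i = ∑ j, (autMatrix b φ -
        a • (1 : Matrix (Fin n) (Fin n) ℤ)) i j * b.repr x j := by
      rw [map_sub, map_smul, Finsupp.sub_apply, repr_apply_eq_sum]
      simp [sub_mul, Finset.sum_sub_distrib, Matrix.one_apply, -zsmul_eq_mul, -zsmul_one]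
    rw [h1]
    exact Finset.dvd_sum fun j _ => (hpd i j).mul_right _
  have hscalar : ∀ x i, ((φ x i : ℤ) : ZMod p) = (a : ZMod p) * (x i : ℤ) := fun x i => by
    have h1 : (p : ℤ) ∣ (φ x - a • x) i := by
      rw [← b.sum_repr (φ x - a • x), Finset.sum_apply]
      exact Finset.dvd_sum fun j _ => (hcoord x j).mul_right _
    have h2 := (ZMod.intCast_zmod_eq_zero_iff_dvd _ _).2 h1
    rw [Pi.sub_apply, Int.cast_sub, sub_eq_zero] at h2
    rw [h2, Pi.smul_apply, smul_eq_mul, Int.cast_mul]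
  -- Otherwise the image of `φ` would vanish modulo `p`, against surjectivity.
  have ha : (a : ZMod p) ≠ 0 := fun h0 => by
    have h1 := hscalar (φ.symm (Pi.single ⟨0, hn⟩ 1)) ⟨0, hn⟩
    rw [φ.apply_symm_apply, h0] at h1
    simp at h1
  have h1 := lt_rank_of_scalar_mod φ ha hscalar
  have h2 := rank_le φ
  omega

theorem ZnMappingTorus.rank_eq_iff_entriesGcd_ne_one (hn : 3 ≤ n) (h0 : 0 < n) :
    Group.rank (ZnMappingTorus φ) = n + 1 ↔
      entriesGcd (autMatrix b φ - (autMatrix b φ ⟨0, h0⟩ ⟨0, h0⟩) •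
        (1 : Matrix (Fin n) (Fin n) ℤ)) ≠ 1 := by
  refine ⟨fun hr h1 => ?_, rank_eq_of_entriesGcd_ne_one φ b h0⟩
  obtain ⟨v, w, hwv, hw⟩ := LinearMap.exists_apply_eq_one
    (φ.toIntLinearEquiv : (Fin n → ℤ) →ₗ[ℤ] (Fin n → ℤ)) (by simpa using hn) fun m hm => by
      have := dvd_entriesGcd_of_forall_dvd φ b h0 hm
      rw [h1, Nat.dvd_one] at this
      exact Int.isUnit_iff_natAbs_eq.2 this
  have := rank_le_of_apply_eq_one φ hwv hw
  omega

end

/-! ### Ranks for `n ≤ 2` and the conclusion -/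

theorem ZnMappingTorus.rank_zero (φ : AddAut (Fin 0 → ℤ)) :
    Group.rank (ZnMappingTorus φ) = 1 := by
  have : Fact (Nat.Prime 2) := ⟨Nat.prime_two⟩
  have h1 := lt_rank_of_scalar_mod φ (p := 2) (a := 1) one_ne_zero fun _ i => i.elim0
  have h2 := rank_le φ
  omega

theorem ZnMappingTorus.rank_one (φ : AddAut (Fin 1 → ℤ)) :
    Group.rank (ZnMappingTorus φ) = 2 := by
  refine rank_eq_of_entriesGcd_ne_one φ (Pi.basisFun ℤ (Fin 1)) one_pos fun h => ?_
  have : 2 ∣ 1 := by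
    rw [← h, dvd_entriesGcd_iff]
    intro i j
    rw [Subsingleton.elim i 0, Subsingleton.elim j 0]
    simp [-zsmul_eq_mul, -zsmul_one]
  norm_num at this

section
variable (φ : AddAut (Fin 2 → ℤ)) (b : Module.Basis (Fin 2) ℤ (Fin 2 → ℤ))

theorem cyclicForm_repr (v : Fin 2 → ℤ) :
    cyclicForm (autMatrix b φ 0 0) (autMatrix b φ 0 1) (autMatrix b φ 1 0) (autMatrix b φ 1 1)
      (b.repr v 0) (b.repr v 1) = b.repr v 0 * b.repr (φ v) 1 - b.repr v 1 * b.repr (φ v) 0 := by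
  simp only [cyclicForm, repr_apply_eq_sum, Fin.sum_univ_two]

theorem ZnMappingTorus.rank_le_two_iff : Group.rank (ZnMappingTorus φ) ≤ 2 ↔
    ∃ x y : ℤ, |cyclicForm (autMatrix b φ 0 0) (autMatrix b φ 0 1) (autMatrix b φ 1 0)
      (autMatrix b φ 1 1) x y| = 1 := by
  constructor
  · intro h
    obtain ⟨u, hu⟩ := exists_closure_pair_eq_top φ h
    refine ⟨b.repr u 0, b.repr u 1, ?_⟩
    rw [cyclicForm_repr, ← Int.isUnit_iff_abs_eq]
    have hmem : ∀ x, ∃ α β : ℤ, α • u + β • φ u = x := fun x =>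
      AddSubgroup.mem_closure_pair.1 (by rw [hu]; trivial)
    obtain ⟨α, β, h0⟩ := hmem (b 0)
    obtain ⟨γ, δ, h1⟩ := hmem (b 1)
    have e00 := congrArg (fun x => b.repr x 0) h0
    have e01 := congrArg (fun x => b.repr x 1) h0
    have e10 := congrArg (fun x => b.repr x 0) h1
    have e11 := congrArg (fun x => b.repr x 1) h1
    simp only [map_add, map_smul, Finsupp.add_apply, Finsupp.smul_apply, smul_eq_mul,
      Module.Basis.repr_self, Finsupp.single_eq_same] at e00 e01 e10 e11
    rw [Finsupp.single_eq_of_ne (by decide)] at e01 e10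
    -- The coefficients expressing the basis in `u, φ u` form the inverse matrix; this is its
    -- determinant.
    refine IsUnit.of_mul_eq_one (α * δ - β * γ) ?_
    linear_combination (γ * b.repr u 1 + δ * b.repr (φ u) 1) * e00 + e11 -
      (γ * b.repr u 0 + δ * b.repr (φ u) 0) * e01
  · rintro ⟨x, y, h⟩
    obtain ⟨v, rfl, rfl⟩ : ∃ v, b.repr v 0 = x ∧ b.repr v 1 = y :=
      ⟨x • b 0 + y • b 1, by simp [-zsmul_eq_mul, -zsmul_one], by simp [-zsmul_eq_mul]⟩
    rw [cyclicForm_repr] at h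
    set Q := b.repr v 0 * b.repr (φ v) 1 - b.repr v 1 * b.repr (φ v) 0 with hQ
    -- The functional is `Q` times `det (v, ·)`; it kills `v` and takes the value `Q * Q = 1` at `φ
    -- v`.
    refine rank_le_of_apply_eq_one φ (v := v)
      (w := Q • (b.repr v 0 • b.coord 1 - b.repr v 1 • b.coord 0)) ?_ ?_
    · simp only [LinearMap.smul_apply, LinearMap.sub_apply, Module.Basis.coord_apply, smul_eq_mul]
      ring
    · simp only [LinearMap.smul_apply, LinearMap.sub_apply, Module.Basis.coord_apply, smul_eq_mul]
      rw [← hQ]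
      exact Int.isUnit_mul_self (Int.isUnit_iff_abs_eq.2 h)

theorem abs_det_autMatrix : |(autMatrix b φ).det| = 1 := by
  rw [autMatrix, LinearMap.det_toMatrix, ← Int.isUnit_iff_abs_eq]
  exact LinearEquiv.isUnit_det' (φ.toIntLinearEquiv : (Fin 2 → ℤ) ≃ₗ[ℤ] (Fin 2 → ℤ))

end

theorem hasMaximalRank_matrixRows_iff {n : ℕ} (φ : AddAut (Fin n → ℤ))
    (b : Module.Basis (Fin n) ℤ (Fin n → ℤ)) :
    HasMaximalRank (matrixRows (autMatrix b φ)) ↔ Group.rank (ZnMappingTorus φ) = n + 1 := by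
  rw [HasMaximalRank, length_matrixRows]
  obtain rfl | rfl | rfl | hn : n = 0 ∨ n = 1 ∨ n = 2 ∨ 3 ≤ n := by omega
  · simp [ZnMappingTorus.rank_zero]
  · simp [ZnMappingTorus.rank_one]
  · have h1 := ZnMappingTorus.rank_le φ
    have h2 := ZnMappingTorus.rank_le_two_iff φ b
    rw [hasSmallCyclicVector_matrixRows_iff _ (abs_det_autMatrix φ b), ← h2]
    omega
  · have h0 : 0 < n := Nat.zero_lt_of_lt hn
    rw [isScalarModSmall_matrixRows_iff _ h0,
      ZnMappingTorus.rank_eq_iff_entriesGcd_ne_one φ b hn h0]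
    omega

theorem theorem1p2 :
    -- one algorithm, for all `n` and all `φ`, with the matrix of `φ` as its input
    (∃ f : List (List ℤ) → Bool, Computable f ∧
      ∀ (n : ℕ) (φ : AddAut (Fin n → ℤ)) (b : Module.Basis (Fin n) ℤ (Fin n → ℤ)),
        f (matrixRows (autMatrix b φ)) = true ↔ Group.rank (ZnMappingTorus φ) = n + 1) ∧
    -- the criterion for `n ≥ 3`
    (∀ (n : ℕ) (hn : 3 ≤ n) (φ : AddAut (Fin n → ℤ))
      (b : Module.Basis (Fin n) ℤ (Fin n → ℤ)),
        Group.rank (ZnMappingTorus φ) = n + 1 ↔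
          entriesGcd (autMatrix b φ -
            (autMatrix b φ ⟨0, by omega⟩ ⟨0, by omega⟩) • (1 : Matrix (Fin n) (Fin n) ℤ)) ≠ 1) := by

  classical
  refine ⟨⟨fun L => decide (HasMaximalRank L), primrecPred_hasMaximalRank.decide.to_comp,
    fun n φ b => ?_⟩, fun n hn φ b => ZnMappingTorus.rank_eq_iff_entriesGcd_ne_one φ b hn _⟩
  rw [decide_eq_true_iff]
  exact hasMaximalRank_matrixRows_iff φ b
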